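/- For an integer $n\ge 0$, a parking function of length $n$ is a vector $(p_1,\dots,p_n)$ of integers with $1\le p_i\le n$ whose weakly increasing rearrangement $p_{(1)}\le\dots\le p_{(n)}$ satisfies $p_{(i)}\le i$ for $1\le i\le n$. Its area is $\mathrm{Area}(p)=\frac{n(n+1)}{2}-\sum_{i=1}^n p_i$. Consider a uniformly random parking function $p$ of length $n$, let $E_1(n)$ be the expectation of $X=\mathrm{Area}(p)$, and let $E_6(n)$ be the sixth factorial moment of the area, that is, the expectation of $X(X-1)(X-2)(X-3)(X-4)(X-5)$. Then for every $n\ge 0$ $$E_1(n)=-\frac n2+\frac12\,\frac{(n+1)!}{(n+1)^n}\sum_{k=0}^{n-1}\frac{(n+1)^k}{k!}$$ and $$\begin{aligned}E_6(n)={}&\tfrac{82825}{576576}n^9+\tfrac{373340075}{110702592}n^8+\tfrac{9401544029}{332107776}n^7+\tfrac{14473244813}{127733760}n^6+\tfrac{414139396709}{1660538880}n^5\\&+\tfrac{88215445651}{332107776}n^4-\tfrac{18783816473}{332107776}n^3-\tfrac{643359542029}{1660538880}n^2-\tfrac{358936540409}{1660538880}n\\&+\Bigl(-\tfrac{3955}{2048}n^7-\tfrac{186349}{6144}n^6-\tfrac{259283273}{1161216}n^5-\tfrac{119912501}{129024}n^4-\tfrac{149860633081}{63866880}n^3\\&\qquad-\tfrac{601794266581}{166053888}n^2-\tfrac{864000570107}{276756480}n-\tfrac{921390308389}{830269440}\Bigr)E_1(n).\end{aligned}$$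 Moreover, as $n\to\infty$, $E_6(n)=\frac{82825}{576576}\,n^9+O(n^{17/2})$. -/

import Mathlib

open Asymptotics Filter

namespace ParkingArea

/-- The parking functions of length `n`: the vectors `p` of integers with `1 ≤ p i ≤ n` whose
weakly increasing rearrangement `p ∘ Tuple.sort p` has its `i`-th entry at most `i`
(the index `i : Fin n` starts at `0`, whence the `+ 1`). -/
def parkingFunctions (n : ℕ) : Finset (Fin n → ℕ) :=
  (Fintype.piFinset fun _ : Fin n => Finset.Icc 1 n).filter
    fun p => ∀ i : Fin n, p (Tuple.sort p i) ≤ (i : ℕ) + 1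

/-- The area statistic `n (n + 1) / 2 - (p 1 + ... + p n)` (as a real number). -/
noncomputable def area {n : ℕ} (p : Fin n → ℕ) : ℝ :=
  (n : ℝ) * ((n : ℝ) + 1) / 2 - ∑ i, (p i : ℝ)

/-- The expectation of a statistic on a uniformly random parking function of length `n`. -/
noncomputable def expectation (n : ℕ) (f : (Fin n → ℕ) → ℝ) : ℝ :=
  (∑ p ∈ parkingFunctions n, f p) / ((parkingFunctions n).card : ℝ)

/-- The `k`-th factorial moment of the area: the expectation of
`area * (area - 1) * ... * (area - k + 1)`. -/
noncomputable def factorialMoment (k n : ℕ) : ℝ :=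
  expectation n fun p => ∏ j ∈ Finset.range k, (area p - (j : ℝ))

/-- The expectation of the area. -/
noncomputable def E₁ (n : ℕ) : ℝ :=
  expectation n fun p => area p

end ParkingArea

/-! ### Decomposition of parking functions at the last car -/

namespace ParkingArea

open Polynomial

/-! Let all cars but the last one park: exactly one spot, `k + 1`, stays empty. The cars to its left
and to its right form independent parking functions of lengths `k` and `n - k`, and the last car may
prefer any of the spots `1, ..., k + 1`. Areas add up along this splitting (`areaEnum_option`),
which gives the recursion `areaEnum_fin_succ`. With `q = 1 + X` its coefficients are binomial
moments of the area.

For the exponential generating functions `F j` of these moments the recursion is a differential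
system with a unique solution for given constant terms (`IsAreaSystem.eq`). Here `F 0 = pf`
satisfies `pf = exp T` with `T = X * pf` the tree function. With `recip = 1 / (1 - T)`, the
operators in the system preserve `pf * ℚ[recip]`, so `F j = pf * R j (recip)` for explicit
polynomials `R j`; for `j ≤ 6` they are verified by integer arithmetic (`derivPf_momentList`).

The coefficients of `pf * recip ^ k` obey a three-term recurrence in `k` (`treeCoeff_rec`), so all
of them are combinations, rational in `n`, of those for `k = 0` and `k = 2`. The former counts
parking functions, the latter encodes the mean; hence the sixth moment has the form `A n + B n * E₁
n`. Finally, Cauchy–Schwarz and the second moment give `E₁ n = O(n ^ (3/2))`, which bounds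
everything below the leading term. -/

/-- The parking functions indexed by a finite type, described by counting. -/
def parkingOn (α : Type*) [Fintype α] [DecidableEq α] : Finset (α → ℕ) :=
  (Fintype.piFinset fun _ : α => Finset.Icc 1 (Fintype.card α)).filter
    fun p => ∀ j ≤ Fintype.card α, j ≤ (Finset.univ.filter fun a => p a ≤ j).card

/-- The area of a parking function as a natural number. -/
def natArea {α : Type*} [Fintype α] (p : α → ℕ) : ℕ :=
  Fintype.card α * (Fintype.card α + 1) / 2 - ∑ a, p a

/-- The area enumerator of parking functions in the variable `1 + X`. -/
noncomputable def areaEnum (α : Type*) [Fintype α] [DecidableEq α] : ℚ[X] :=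
  ∑ p ∈ parkingOn α, (1 + X) ^ natArea p

section general

set_option linter.unusedSectionVars false

variable {α : Type*} [Fintype α] [DecidableEq α]

/-- The upper bound on the values is redundant: the counting condition at `j = Fintype.card α`
already forces it. -/
theorem mem_parkingOn {p : α → ℕ} : p ∈ parkingOn α ↔
    (∀ a, 1 ≤ p a) ∧
      ∀ j ≤ Fintype.card α, j ≤ (Finset.univ.filter fun a => p a ≤ j).card := by
  simp only [parkingOn, Finset.mem_filter, Fintype.mem_piFinset, Finset.mem_Icc]
  constructor
  · rintro ⟨h, h'⟩
    exact ⟨fun a => (h a).1, h'⟩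
  · rintro ⟨h, h'⟩
    refine ⟨fun a => ⟨h a, ?_⟩, h'⟩
    have h1 := Finset.eq_univ_of_card _
      (le_antisymm (Finset.card_le_univ _) (h' _ le_rfl))
    have h2 := Finset.mem_univ a
    rw [← h1] at h2
    simpa using h2

theorem le_card_of_mem_parkingOn {p : α → ℕ} (hp : p ∈ parkingOn α) (a : α) :
    p a ≤ Fintype.card α := by
  have := (Finset.mem_filter.1 hp).1
  rw [Fintype.mem_piFinset] at this
  exact (Finset.mem_Icc.1 (this a)).2

theorem two_mul_half_mul_succ (m : ℕ) : 2 * (m * (m + 1) / 2) = m * (m + 1) :=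
  Nat.mul_div_cancel' (Nat.even_mul_succ_self m).two_dvd

/-- The area bookkeeping of the splitting: `m * (k + 1)` pays for the shift of the right block and
the last `k + 1` for the last car. -/
theorem half_mul_succ_add (k m : ℕ) :
    (k + m + 1) * (k + m + 1 + 1) / 2 =
      k * (k + 1) / 2 + m * (m + 1) / 2 + m * (k + 1) + (k + 1) := by
  have h1 := two_mul_half_mul_succ (k + m + 1)
  have h2 := two_mul_half_mul_succ k
  have h3 := two_mul_half_mul_succ m
  nlinarith

/-- Double counting of the pairs `p a ≤ j`. It ensures that the subtraction in `natArea` is never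
truncated. -/
theorem sum_le_of_mem_parkingOn {p : α → ℕ} (hp : p ∈ parkingOn α) :
    ∑ a, p a ≤ Fintype.card α * (Fintype.card α + 1) / 2 := by
  set n := Fintype.card α with hn
  have h1 : ∀ a, p a + ((Finset.range (n + 1)).filter fun j => p a ≤ j).card = n + 1 := by
    intro a
    have h := le_card_of_mem_parkingOn hp a
    have : ((Finset.range (n + 1)).filter fun j => p a ≤ j) = Finset.Ico (p a) (n + 1) := by
      ext j
      simp only [Finset.mem_filter, Finset.mem_range, Finset.mem_Ico]
      tauto
    rw [this, Nat.card_Ico]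
    omega
  have h2 : ∑ a, p a + ∑ a, ((Finset.range (n + 1)).filter fun j => p a ≤ j).card
      = n * (n + 1) := by
    rw [← Finset.sum_add_distrib, Finset.sum_congr rfl fun a _ => h1 a]
    simp [← hn]
  have h3 : ∑ a, ((Finset.range (n + 1)).filter fun j => p a ≤ j).card =
      ∑ j ∈ Finset.range (n + 1), (Finset.univ.filter fun a => p a ≤ j).card := by
    simp only [Finset.card_filter]
    exact Finset.sum_comm
  have h4 : ∑ j ∈ Finset.range (n + 1), j ≤
      ∑ j ∈ Finset.range (n + 1), (Finset.univ.filter fun a => p a ≤ j).card :=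
    Finset.sum_le_sum fun j hj => (mem_parkingOn.1 hp).2 j (by
      have := Finset.mem_range.1 hj
      omega)
  have h5 := Finset.sum_range_id_mul_two (n + 1)
  have h6 := two_mul_half_mul_succ n
  simp only [Nat.add_sub_cancel] at h5
  nlinarith

theorem natArea_add_sum {p : α → ℕ} (hp : p ∈ parkingOn α) :
    natArea p + ∑ a, p a = Fintype.card α * (Fintype.card α + 1) / 2 :=
  Nat.sub_add_cancel (sum_le_of_mem_parkingOn hp)

theorem areaEnum_congr {β : Type*} [Fintype β] [DecidableEq β] (e : α ≃ β) :
    areaEnum α = areaEnum β := by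
  have hc := Fintype.card_congr e
  unfold areaEnum
  refine Finset.sum_equiv (e.arrowCongr (Equiv.refl ℕ)) (fun p => ?_) (fun p _ => ?_)
  · simp only [mem_parkingOn, ← hc]
    refine and_congr ?_ (forall_congr' fun j => imp_congr_right fun _ => ?_)
    · exact e.forall_congr fun a => by simp
    · have : (Finset.univ.filter fun a => p a ≤ j).card =
          (Finset.univ.filter fun b => (e.arrowCongr (Equiv.refl ℕ)) p b ≤ j).card :=
        Finset.card_equiv e fun a => by simp
      rw [this]
  · have : ∑ a, p a = ∑ b, (e.arrowCongr (Equiv.refl ℕ)) p b :=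
      Fintype.sum_equiv e _ _ fun a => by simp
    rw [natArea, natArea, this, hc]

/-- Glue a function on `S` and a function on the complement of `S`, raised by `#S + 1`. -/
def glue (S : Finset α) (p : {a // a ∈ S} → ℕ) (q : {a // a ∉ S} → ℕ) (a : α) : ℕ :=
  if h : a ∈ S then p ⟨a, h⟩ else q ⟨a, h⟩ + (S.card + 1)

theorem glue_mem {S : Finset α} {p : {a // a ∈ S} → ℕ} {q : {a // a ∉ S} → ℕ} (a : {a // a ∈ S}) :
    glue S p q a = p a := by
  simp [glue]

theorem glue_not_mem {S : Finset α} {p : {a // a ∈ S} → ℕ} {q : {a // a ∉ S} → ℕ}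
    (a : {a // a ∉ S}) : glue S p q a = q a + (S.card + 1) := by
  simp [glue, a.2]

theorem card_glue_le (S : Finset α) (p : {a // a ∈ S} → ℕ) (q : {a // a ∉ S} → ℕ) (j : ℕ) :
    (Finset.univ.filter fun a => glue S p q a ≤ j).card =
      (Finset.univ.filter fun a => p a ≤ j).card +
        (Finset.univ.filter fun a => q a + (S.card + 1) ≤ j).card := by
  simp only [Finset.card_filter]
  rw [← Fintype.sum_subtype_add_sum_subtype (fun a => a ∈ S)]
  simp only [glue_mem, glue_not_mem]
  congr!

theorem sum_glue (S : Finset α) (p : {a // a ∈ S} → ℕ) (q : {a // a ∉ S} → ℕ) :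
    ∑ a, glue S p q a =
      ∑ a, p a + (∑ a, q a + (Fintype.card α - S.card) * (S.card + 1)) := by
  rw [← Fintype.sum_subtype_add_sum_subtype (fun a => a ∈ S)]
  simp only [glue_mem, glue_not_mem, Finset.sum_add_distrib, Finset.sum_const, smul_eq_mul,
    Finset.card_univ, Fintype.card_subtype_compl, Fintype.card_coe, mul_add, mul_one]
  congr!

/-- No glued car prefers the empty spot `S.card + 1`, so the thresholds `S.card` and `S.card + 1`
both cut out `S`; this is how `S` is recovered from the glued function. -/
theorem glue_le_iff {S : Finset α} {p : {a // a ∈ S} → ℕ} {q : {a // a ∉ S} → ℕ}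
    (hp : p ∈ parkingOn {a // a ∈ S}) (hq : q ∈ parkingOn {a // a ∉ S}) {j : ℕ}
    (hj : S.card ≤ j) (hj' : j ≤ S.card + 1) (a : α) : glue S p q a ≤ j ↔ a ∈ S := by
  by_cases h : a ∈ S
  · have := le_card_of_mem_parkingOn hp ⟨a, h⟩
    rw [Fintype.card_coe] at this
    simp only [glue, h, dite_true, iff_true]
    omega
  · have := (mem_parkingOn.1 hq).1 ⟨a, h⟩
    simp only [glue, h, dite_false, iff_false]
    omega

theorem card_option_le (f : Option α → ℕ) (j : ℕ) :
    (Finset.univ.filter fun o => f o ≤ j).card =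
      (if f none ≤ j then 1 else 0) + (Finset.univ.filter fun a => f (some a) ≤ j).card := by
  simp only [Finset.card_filter, Fintype.sum_option]

/-- Insert the value of a last car. -/
def consOption (i : ℕ) (f : α → ℕ) : Option α → ℕ := fun o => o.elim i f

theorem consOption_none (i : ℕ) (f : α → ℕ) : consOption i f none = i := rfl

theorem consOption_some (i : ℕ) (f : α → ℕ) (a : α) : consOption i f (some a) = f a := rfl

theorem card_consOption_le (i : ℕ) (f : α → ℕ) (j : ℕ) :
    (Finset.univ.filter fun o => consOption i f o ≤ j).card =
      (if i ≤ j then 1 else 0) + (Finset.univ.filter fun a => f a ≤ j).card :=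
  card_option_le (consOption i f) j

theorem le_card_left {S : Finset α} {p : {a // a ∈ S} → ℕ} (hp : p ∈ parkingOn {a // a ∈ S})
    (j : ℕ) : min j S.card ≤ (Finset.univ.filter fun a => p a ≤ j).card := by
  have h := (mem_parkingOn.1 hp).2 (min j S.card) (by simp)
  refine h.trans (Finset.card_le_card fun a ha => ?_)
  simp only [Finset.mem_filter, Finset.mem_univ, true_and] at ha ⊢
  exact ha.trans (min_le_left _ _)

theorem consOption_glue_mem {S : Finset α} {p : {a // a ∈ S} → ℕ} {q : {a // a ∉ S} → ℕ} {i : ℕ}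
    (hp : p ∈ parkingOn {a // a ∈ S}) (hq : q ∈ parkingOn {a // a ∉ S}) (hi : i < S.card + 1) :
    consOption (S.card + 1 - i) (glue S p q) ∈ parkingOn (Option α) := by
  rw [mem_parkingOn]
  constructor
  · rintro (_ | a)
    · simp only [consOption_none]
      omega
    · simp only [consOption_some, glue]
      split_ifs with h
      · exact (mem_parkingOn.1 hp).1 _
      · omega
  · intro j hj
    rw [card_consOption_le, card_glue_le]
    have h1 := le_card_left hp j
    rw [Fintype.card_option] at hj
    rcases le_or_gt j S.card with h | h
    · rw [min_eq_left h] at h1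
      omega
    · rw [min_eq_right h.le] at h1
      have h2 := (mem_parkingOn.1 hq).2 (j - (S.card + 1)) (by
        rw [Fintype.card_subtype_compl, Fintype.card_coe]
        omega)
      have h3 : (Finset.univ.filter fun a => q a + (S.card + 1) ≤ j) =
          (Finset.univ.filter fun a => q a ≤ j - (S.card + 1)) := by
        ext a
        simp only [Finset.mem_filter, Finset.mem_univ, true_and]
        omega
      rw [h3, if_pos (by omega)]
      omega

theorem natArea_consOption_glue {S : Finset α} {p : {a // a ∈ S} → ℕ} {q : {a // a ∉ S} → ℕ}
    {i : ℕ} (hp : p ∈ parkingOn {a // a ∈ S}) (hq : q ∈ parkingOn {a // a ∉ S})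
    (hi : i < S.card + 1) :
    natArea (consOption (S.card + 1 - i) (glue S p q)) = natArea p + natArea q + i := by
  have h := natArea_add_sum (consOption_glue_mem hp hq hi)
  have h1 := natArea_add_sum hp
  have h2 := natArea_add_sum hq
  have h3 := half_mul_succ_add S.card (Fintype.card α - S.card)
  have hS : S.card ≤ Fintype.card α := Finset.card_le_univ S
  rw [Nat.add_sub_cancel' hS] at h3
  simp only [Fintype.sum_option, consOption_none, consOption_some, sum_glue, Fintype.card_option,
    Fintype.card_subtype_compl, Fintype.card_coe] at h h1 h2
  omega

/-- If `S'` were larger, at least `S.card + 1` cars would prefer a spot up to `S.card + 1`, whereas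
only the cars of `S` do. -/
theorem glue_injective {S S' : Finset α} {p : {a // a ∈ S} → ℕ} {q : {a // a ∉ S} → ℕ}
    {p' : {a // a ∈ S'} → ℕ} {q' : {a // a ∉ S'} → ℕ}
    (hp : p ∈ parkingOn {a // a ∈ S}) (hq : q ∈ parkingOn {a // a ∉ S})
    (hp' : p' ∈ parkingOn {a // a ∈ S'}) (h : glue S p q = glue S' p' q') :
    S'.card ≤ S.card := by
  by_contra! hlt
  have h1 := le_card_left hp' (S.card + 1)
  rw [min_eq_left hlt] at h1
  have h2 := card_glue_le S' p' q' (S.card + 1)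
  rw [← h, Finset.filter_congr fun a _ => glue_le_iff hp hq (Nat.le_succ _) le_rfl a] at h2
  simp only [Finset.filter_univ_mem] at h2
  omega

theorem exists_glue {f : Option α → ℕ} (hf : f ∈ parkingOn (Option α)) :
    ∃ (S : Finset α) (p : {a // a ∈ S} → ℕ) (q : {a // a ∉ S} → ℕ) (i : ℕ),
      p ∈ parkingOn {a // a ∈ S} ∧ q ∈ parkingOn {a // a ∉ S} ∧ i < S.card + 1 ∧
        consOption (S.card + 1 - i) (glue S p q) = f := by
  classical
  obtain ⟨hf1, hf2⟩ := mem_parkingOn.1 hf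
  set c : ℕ → ℕ := fun j => (Finset.univ.filter fun a => f (some a) ≤ j).card with hc
  -- The least failure `k + 1` of the counting condition is the spot that the cars other than `none`
  -- leave empty.
  have hex : ∃ j, c (j + 1) < j + 1 :=
    ⟨Fintype.card α, Nat.lt_succ_of_le (Finset.card_le_univ _)⟩
  obtain ⟨k, hk1, hk2⟩ : ∃ k, c (k + 1) < k + 1 ∧ ∀ j < k, j + 1 ≤ c (j + 1) :=
    ⟨Nat.find hex, Nat.find_spec hex, fun j hj => not_lt.1 (Nat.find_min hex hj)⟩
  have hk3 : ∀ j ≤ k, j ≤ c j := by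
    rintro (_ | j) hj
    · exact Nat.zero_le _
    · exact hk2 j hj
  have hcm : ∀ i j, i ≤ j → c i ≤ c j := fun i j hij =>
    Finset.card_le_card fun a ha => by
      simp only [Finset.mem_filter, Finset.mem_univ, true_and] at ha ⊢
      exact ha.trans hij
  set S := Finset.univ.filter fun a => f (some a) ≤ k with hS
  have hSk : S.card = k := le_antisymm
    ((hcm k (k + 1) (Nat.le_succ k)).trans (Nat.le_of_lt_succ hk1)) (hk3 k le_rfl)
  have hkn : k ≤ Fintype.card α := hSk ▸ Finset.card_le_univ S
  -- The thresholds `k` and `k + 1` count equally many cars, so none prefers `k + 1`.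
  have hbig : ∀ a, a ∉ S → k + 2 ≤ f (some a) := by
    intro a ha
    by_contra! hlt
    have hss : S ⊆ Finset.univ.filter fun a => f (some a) ≤ k + 1 := fun b hb => by
      simp only [hS, Finset.mem_filter, Finset.mem_univ, true_and] at hb ⊢
      omega
    have heq := Finset.eq_of_subset_of_card_le hss (by
      rw [hSk]
      exact Nat.le_of_lt_succ hk1)
    apply ha
    rw [heq]
    simp only [Finset.mem_filter, Finset.mem_univ, true_and]
    omega
  set p : {a // a ∈ S} → ℕ := fun a => f (some a)
  set q : {a // a ∉ S} → ℕ := fun a => f (some a) - (k + 1) with hq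
  have hglue : glue S p q = fun a => f (some a) := by
    funext a
    by_cases h : a ∈ S
    · simp [glue, h, p]
    · have := hbig a h
      simp only [glue, h, dite_false, q, hSk]
      omega
  have hcg : ∀ j, c j = (Finset.univ.filter fun a => p a ≤ j).card +
        (Finset.univ.filter fun a => q a + (k + 1) ≤ j).card := by
    intro j
    have := card_glue_le S p q j
    rw [hglue, hSk] at this
    exact this
  have hnone : f none ≤ k + 1 := by
    by_contra! hlt
    have h := hf2 (k + 1) (by rw [Fintype.card_option]; omega)
    rw [card_option_le, if_neg (by omega)] at h
    change k + 1 ≤ 0 + c (k + 1) at h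
    omega
  have h1 := hf1 none
  -- The last witness is the displacement of the last car, which ends in spot `k + 1`.
  refine ⟨S, p, q, k + 1 - f none, ?_, ?_, ?_, ?_⟩
  · refine mem_parkingOn.2 ⟨fun a => hf1 _, fun j hj => ?_⟩
    rw [Fintype.card_coe, hSk] at hj
    have h2 := hk3 j hj
    have h3 : (Finset.univ.filter fun a => q a + (k + 1) ≤ j) = ∅ :=
      Finset.filter_false_of_mem fun a _ => by omega
    rw [hcg, h3, Finset.card_empty] at h2
    exact h2
  · refine mem_parkingOn.2 ⟨fun a => ?_, fun j hj => ?_⟩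
    · have := hbig a a.2
      simp only [hq]
      omega
    · rw [Fintype.card_subtype_compl, Fintype.card_coe, hSk] at hj
      have h2 := hf2 (j + (k + 1)) (by rw [Fintype.card_option]; omega)
      rw [card_option_le, if_pos (by omega)] at h2
      change _ ≤ 1 + c _ at h2
      have h3 := Finset.card_le_univ (Finset.univ.filter fun a => p a ≤ j + (k + 1))
      rw [Fintype.card_coe, hSk] at h3
      rw [hcg] at h2
      simp only [add_le_add_iff_right] at h2
      omega
  · omega
  · funext o
    rcases o with _ | a
    · simp only [consOption_none]
      omega
    · simp only [consOption_some, hglue]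

/-- The geometric sum records the displacement of the last car, an arbitrary number from `0` to
`S.card`, which is its contribution to the area. -/
theorem areaEnum_option : areaEnum (Option α) =
    ∑ S : Finset α, (∑ i ∈ Finset.range (S.card + 1), (1 + X) ^ i) *
      (areaEnum {a // a ∈ S} * areaEnum {a // a ∉ S}) := by
  have hR : ∀ S : Finset α, (∑ i ∈ Finset.range (S.card + 1), (1 + X : ℚ[X]) ^ i) *
      (areaEnum {a // a ∈ S} * areaEnum {a // a ∉ S}) =
      ∑ x ∈ Finset.range (S.card + 1) ×ˢ (parkingOn {a // a ∈ S} ×ˢ parkingOn {a // a ∉ S}),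
        (1 + X) ^ (natArea x.2.1 + natArea x.2.2 + x.1) := by
    intro S
    rw [areaEnum, areaEnum, Finset.sum_mul_sum, ← Finset.sum_product', Finset.sum_mul_sum,
      ← Finset.sum_product']
    refine Finset.sum_congr rfl fun x _ => ?_
    rw [pow_add, pow_add]
    ring
  rw [Finset.sum_congr rfl fun S _ => hR S, Finset.sum_sigma', areaEnum]
  symm
  refine Finset.sum_bij
    (fun x _ => consOption (x.1.card + 1 - x.2.1) (glue x.1 x.2.2.1 x.2.2.2)) ?_ ?_ ?_ ?_
  · rintro ⟨S, i, p, q⟩ hx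
    simp only [Finset.mem_sigma, Finset.mem_univ, true_and, Finset.mem_product,
      Finset.mem_range] at hx
    exact consOption_glue_mem hx.2.1 hx.2.2 hx.1
  · rintro ⟨S, i, p, q⟩ hx ⟨S', i', p', q'⟩ hx' h
    simp only [Finset.mem_sigma, Finset.mem_univ, true_and, Finset.mem_product,
      Finset.mem_range] at hx hx' h
    have h0 : S.card + 1 - i = S'.card + 1 - i' := congrFun h none
    have h1 : glue S p q = glue S' p' q' := funext fun a => congrFun h (some a)
    have hc : S.card = S'.card := le_antisymm
      (glue_injective hx'.2.1 hx'.2.2 hx.2.1 h1.symm) (glue_injective hx.2.1 hx.2.2 hx'.2.1 h1)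
    obtain rfl : S = S' := by
      ext a
      rw [← glue_le_iff hx.2.1 hx.2.2 le_rfl (Nat.le_succ _), h1, hc,
        glue_le_iff hx'.2.1 hx'.2.2 le_rfl (Nat.le_succ _)]
    obtain rfl : i = i' := by omega
    obtain rfl : p = p' := funext fun a => by
      have := congrFun h1 a
      rwa [glue_mem, glue_mem] at this
    obtain rfl : q = q' := funext fun a => by
      have := congrFun h1 a
      rwa [glue_not_mem, glue_not_mem, Nat.add_right_cancel_iff] at this
    rfl
  · intro f hf
    obtain ⟨S, p, q, i, hp, hq, hi, h⟩ := exists_glue hf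
    exact ⟨⟨S, i, p, q⟩, by simp [hp, hq]; omega, h⟩
  · rintro ⟨S, i, p, q⟩ hx
    simp only [Finset.mem_sigma, Finset.mem_univ, true_and, Finset.mem_product,
      Finset.mem_range] at hx
    rw [natArea_consOption_glue hx.2.1 hx.2.2 hx.1]

end general

theorem areaEnum_fin_succ (n : ℕ) : areaEnum (Fin (n + 1)) =
    ∑ k ∈ Finset.range (n + 1), (n.choose k : ℚ[X]) *
      ((∑ i ∈ Finset.range (k + 1), (1 + X) ^ i) *
        (areaEnum (Fin k) * areaEnum (Fin (n - k)))) := by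
  have hS : ∀ S : Finset (Fin n), (∑ i ∈ Finset.range (S.card + 1), (1 + X : ℚ[X]) ^ i) *
      (areaEnum {a // a ∈ S} * areaEnum {a // a ∉ S}) =
      (fun k => (∑ i ∈ Finset.range (k + 1), (1 + X) ^ i) *
        (areaEnum (Fin k) * areaEnum (Fin (n - k)))) S.card := by
    intro S
    simp only
    rw [areaEnum_congr (Fintype.equivFinOfCardEq (α := {a // a ∈ S}) (Fintype.card_coe S)),
      areaEnum_congr (Fintype.equivFinOfCardEq (α := {a // a ∉ S}) (n := n - S.card)
        (by rw [Fintype.card_subtype_compl, Fintype.card_coe, Fintype.card_fin]))]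
  rw [areaEnum_congr (finSuccEquiv n), areaEnum_option, Finset.sum_congr rfl fun S _ => hS S,
    ← Finset.powerset_univ]
  refine (Finset.sum_powerset_apply_card (fun k => (∑ i ∈ Finset.range (k + 1), (1 + X : ℚ[X]) ^ i) *
    (areaEnum (Fin k) * areaEnum (Fin (n - k))))).trans ?_
  simp only [Finset.card_univ, Fintype.card_fin, nsmul_eq_mul]

/-! ### Binomial moments of the area -/

theorem parkingFunctions_eq (n : ℕ) : parkingFunctions n = parkingOn (Fin n) := by
  ext p
  simp only [parkingFunctions, parkingOn, Finset.mem_filter, Fintype.card_fin]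
  refine and_congr_right fun _ => ?_
  have hcard : ∀ j, (Finset.univ.filter fun a => p a ≤ j).card =
      (Finset.univ.filter fun i => (p ∘ Tuple.sort p) i ≤ j).card := fun j =>
    (Finset.card_equiv (Tuple.sort p) fun a => by simp).symm
  -- An entry of the sorted vector is at most `j` exactly when its 0-based index is below the number
  -- of values at most `j`.
  have key : ∀ (i : Fin n) (j : ℕ), p (Tuple.sort p i) ≤ j ↔
      (i : ℕ) < (Finset.univ.filter fun a => p a ≤ j).card := fun i j => by
    rw [hcard]
    exact (Tuple.lt_card_le_iff_apply_le_of_monotone (Tuple.monotone_sort p)).symm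
  constructor
  · rintro h (_ | j) hj
    · exact Nat.zero_le _
    · exact (key ⟨j, hj⟩ (j + 1)).1 (h ⟨j, hj⟩)
  · intro h i
    exact (key i _).2 (h _ i.2)

/-- The sum of the binomial coefficients of the area, over all parking functions. -/
def areaMoment (j n : ℕ) : ℚ :=
  ∑ p ∈ parkingFunctions n, ((natArea p).choose j : ℚ)

theorem coeff_areaEnum (j n : ℕ) : (areaEnum (Fin n)).coeff j = areaMoment j n := by
  rw [areaEnum, finsetSum_coeff, areaMoment, parkingFunctions_eq]
  exact Finset.sum_congr rfl fun p _ => coeff_one_add_X_pow _ _ _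

/-- Hockey-stick identity: the sum is `((1 + X) ^ (k + 1) - 1) / X`. -/
theorem coeff_geom (k l : ℕ) :
    (∑ i ∈ Finset.range (k + 1), (1 + X : ℚ[X]) ^ i).coeff l = ((k + 1).choose (l + 1) : ℚ) := by
  rw [finsetSum_coeff]
  simp only [coeff_one_add_X_pow]
  induction k with
  | zero => cases l <;> simp [Nat.choose_eq_zero_of_lt]
  | succ k ih => rw [Finset.sum_range_succ, ih, ← Nat.cast_add, add_comm, ← Nat.choose_succ_succ]

theorem areaMoment_succ (j n : ℕ) : areaMoment j (n + 1) =
    ∑ k ∈ Finset.range (n + 1), (n.choose k : ℚ) *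
      ∑ x ∈ Finset.HasAntidiagonal.antidiagonal j, ((k + 1).choose (x.1 + 1) : ℚ) *
        ∑ y ∈ Finset.HasAntidiagonal.antidiagonal x.2, areaMoment y.1 k * areaMoment y.2 (n - k) := by
  rw [← coeff_areaEnum, areaEnum_fin_succ, finsetSum_coeff]
  refine Finset.sum_congr rfl fun k _ => ?_
  rw [← C_eq_natCast, coeff_C_mul, coeff_mul]
  simp only [coeff_geom, coeff_mul, coeff_areaEnum]

theorem areaMoment_zero (j : ℕ) : areaMoment j 0 = if j = 0 then 1 else 0 := by
  rw [areaMoment, parkingFunctions_eq]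
  have : parkingOn (Fin 0) = {Fin.elim0} := by
    ext p
    simp [mem_parkingOn, Subsingleton.elim p Fin.elim0]
  rw [this]
  cases j <;> simp [natArea]

theorem area_eq_natArea {n : ℕ} {p : Fin n → ℕ} (hp : p ∈ parkingFunctions n) :
    area p = natArea p := by
  rw [parkingFunctions_eq] at hp
  have h1 := natArea_add_sum hp
  have h2 := two_mul_half_mul_succ n
  rw [Fintype.card_fin] at h1
  rw [← h1] at h2
  have h3 : (2 : ℝ) * (natArea p + ∑ i, (p i : ℝ)) = n * (n + 1) := by exact_mod_cast h2
  rw [area, ← h3]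
  ring

theorem factorialMoment_eq (k n : ℕ) :
    factorialMoment k n = k.factorial * areaMoment k n / areaMoment 0 n := by
  rw [factorialMoment, expectation, areaMoment, areaMoment]
  push_cast
  rw [Finset.mul_sum]
  congr 1
  · refine Finset.sum_congr rfl fun p hp => ?_
    rw [area_eq_natArea hp, ← Nat.cast_mul, ← Nat.descFactorial_eq_factorial_mul_choose,
      ← descPochhammer_eval_eq_descFactorial ℝ, descPochhammer_eval_eq_prod_range]
  · simp

theorem E₁_eq (n : ℕ) : E₁ n = areaMoment 1 n / areaMoment 0 n := by
  have h := factorialMoment_eq 1 n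
  simp only [factorialMoment, Finset.prod_range_one, Nat.cast_zero, sub_zero] at h
  rw [E₁, h]
  simp

end ParkingArea

namespace ParkingArea

open PowerSeries

/-! ### Binomial differential operators -/

/-- The operator multiplying the coefficient of `X ^ k` by `(k + 1).choose (l + 1)`. -/
noncomputable def binomOp (l : ℕ) (F : ℚ⟦X⟧) : ℚ⟦X⟧ :=
  mk fun k => ((k + 1).choose (l + 1) : ℚ) * coeff k F

theorem coeff_X_mul_derivative (F : ℚ⟦X⟧) (k : ℕ) :
    coeff k (X * d⁄dX ℚ F) = k * coeff k F := by
  cases k with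
  | zero => simp
  | succ k =>
    rw [coeff_succ_X_mul, coeff_derivative]
    push_cast
    ring

theorem binomOp_zero (F : ℚ⟦X⟧) : binomOp 0 F = X * d⁄dX ℚ F + F := by
  ext k
  rw [map_add, coeff_X_mul_derivative, binomOp, coeff_mk]
  simp
  ring

/-- Coefficientwise this is `(l + 2) * (k + 1).choose (l + 2) = (k - l) * (k + 1).choose (l + 1)`;
it reduces every `binomOp` to iterates of `X * d/dX`. -/
theorem binomOp_succ (l : ℕ) (F : ℚ⟦X⟧) :
    ((l : ℚ⟦X⟧) + 2) * binomOp (l + 1) F = X * d⁄dX ℚ (binomOp l F) - (l : ℚ⟦X⟧) * binomOp l F := by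
  have h : (l : ℚ⟦X⟧) = C (l : ℚ) := (map_natCast (C (R := ℚ)) l).symm
  have h2 : (l : ℚ⟦X⟧) + 2 = C ((l : ℚ) + 2) := by
    rw [map_add, map_natCast, map_ofNat]
  ext k
  rw [map_sub, coeff_X_mul_derivative, h2, h, coeff_C_mul, coeff_C_mul, binomOp, binomOp, coeff_mk,
    coeff_mk]
  have := Nat.choose_succ_right_eq (k + 1) (l + 1)
  rcases le_or_gt l k with hlk | hlk
  · obtain ⟨m, rfl⟩ := Nat.exists_eq_add_of_le hlk
    have h3 : l + m + 1 - (l + 1) = m := by omega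
    rw [h3] at this
    have h4 : (((l + m + 1).choose (l + 1 + 1) : ℕ) : ℚ) * (l + 1 + 1) =
        ((l + m + 1).choose (l + 1) : ℕ) * m := by exact_mod_cast this
    push_cast
    linear_combination (coeff (l + m) F) * h4
  · rw [Nat.choose_eq_zero_of_lt (show k + 1 < l + 1 by omega),
      Nat.choose_eq_zero_of_lt (show k + 1 < l + 1 + 1 by omega)]
    simp

/-! ### The differential system -/

/-- The differential system satisfied by the exponential generating functions of the binomial
moments of the area. -/
def IsAreaSystem (F : ℕ → ℚ⟦X⟧) (j : ℕ) : Prop :=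
  d⁄dX ℚ (F j) = ∑ x ∈ Finset.HasAntidiagonal.antidiagonal j,
    ∑ y ∈ Finset.HasAntidiagonal.antidiagonal x.2, binomOp x.1 (F y.1) * F y.2

/-- The exponential generating function of the `j`-th binomial moments of the area. -/
noncomputable def areaSeries (j : ℕ) : ℚ⟦X⟧ :=
  mk fun n => areaMoment j n / n.factorial

theorem isAreaSystem_areaSeries (j : ℕ) : IsAreaSystem areaSeries j := by
  unfold IsAreaSystem
  ext n
  rw [coeff_derivative, areaSeries, coeff_mk, areaMoment_succ]
  simp only [map_sum, coeff_mul, binomOp, areaSeries, coeff_mk]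
  have hswap : ∀ f : ℕ × ℕ → ℕ × ℕ → ℕ × ℕ → ℚ,
      ∑ x ∈ Finset.HasAntidiagonal.antidiagonal j,
        ∑ y ∈ Finset.HasAntidiagonal.antidiagonal x.2,
          ∑ z ∈ Finset.HasAntidiagonal.antidiagonal n, f x y z =
      ∑ k ∈ Finset.range (n + 1), ∑ x ∈ Finset.HasAntidiagonal.antidiagonal j,
        ∑ y ∈ Finset.HasAntidiagonal.antidiagonal x.2, f x y (k, n - k) := by
    intro f
    rw [← Finset.Nat.sum_antidiagonal_eq_sum_range_succ_mk (fun z =>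
      ∑ x ∈ Finset.HasAntidiagonal.antidiagonal j,
        ∑ y ∈ Finset.HasAntidiagonal.antidiagonal x.2, f x y z) n, Finset.sum_comm]
    exact Finset.sum_congr rfl fun x _ => Finset.sum_comm
  rw [hswap, Finset.sum_div, Finset.sum_mul]
  refine Finset.sum_congr rfl fun k hk => ?_
  have hkn : k ≤ n := Nat.lt_succ_iff.1 (Finset.mem_range.1 hk)
  have hch : (n.choose k : ℚ) / (n + 1).factorial * (n + 1) =
      1 / (k.factorial * (n - k).factorial) := by
    have h1 : (n.choose k * k.factorial * (n - k).factorial : ℚ) = n.factorial := by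
      exact_mod_cast Nat.choose_mul_factorial_mul_factorial hkn
    rw [Nat.factorial_succ]
    push_cast
    rw [← h1]
    have h2 : (n.choose k : ℚ) ≠ 0 := by exact_mod_cast (Nat.choose_pos hkn).ne'
    field_simp
  rw [mul_div_right_comm, mul_right_comm, hch, Finset.mul_sum]
  refine Finset.sum_congr rfl fun x _ => ?_
  rw [Finset.mul_sum, Finset.mul_sum]
  refine Finset.sum_congr rfl fun y _ => ?_
  ring

/-- `binomOp` acts diagonally on coefficients, so coefficient `n + 1` of `F j` is determined by the
coefficients up to `n` of the `F i` with `i ≤ j`. -/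
theorem IsAreaSystem.coeff_eq {F G : ℕ → ℚ⟦X⟧} {J : ℕ} (hF : ∀ j ≤ J, IsAreaSystem F j)
    (hG : ∀ j ≤ J, IsAreaSystem G j)
    (h0 : ∀ j ≤ J, constantCoeff (F j) = constantCoeff (G j)) (n : ℕ) :
    ∀ j ≤ J, coeff n (F j) = coeff n (G j) := by
  induction n using Nat.strong_induction_on with
  | _ n ih =>
    intro j hj
    cases n with
    | zero => simpa using h0 j hj
    | succ n =>
      have h : coeff n (d⁄dX ℚ (F j)) = coeff n (d⁄dX ℚ (G j)) := by
        rw [hF j hj, hG j hj]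
        simp only [map_sum, coeff_mul, binomOp, coeff_mk]
        refine Finset.sum_congr rfl fun x hx => Finset.sum_congr rfl fun y hy =>
          Finset.sum_congr rfl fun z hz => ?_
        rw [Finset.HasAntidiagonal.mem_antidiagonal] at hx hy hz
        rw [ih z.1 (by omega) y.1 (by omega), ih z.2 (by omega) y.2 (by omega)]
      rw [coeff_derivative, coeff_derivative] at h
      exact mul_right_cancel₀ (by positivity) h

theorem IsAreaSystem.eq {F G : ℕ → ℚ⟦X⟧} {J : ℕ} (hF : ∀ j ≤ J, IsAreaSystem F j)
    (hG : ∀ j ≤ J, IsAreaSystem G j)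
    (h0 : ∀ j ≤ J, constantCoeff (F j) = constantCoeff (G j)) {j : ℕ} (hj : j ≤ J) :
    F j = G j := by
  ext n
  exact IsAreaSystem.coeff_eq hF hG h0 n j hj

/-! ### The tree function -/

/-- The exponential generating function of the numbers of parking functions. -/
noncomputable def pf : ℚ⟦X⟧ := areaSeries 0

/-- The reciprocal of `1 - T`, where `T = X * pf` is the tree function. -/
noncomputable def recip : ℚ⟦X⟧ := (1 - X * pf)⁻¹

theorem one_sub_mul_recip : (1 - X * pf) * recip = 1 :=
  PowerSeries.mul_inv_cancel _ (by simp)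

theorem X_mul_pf_mul_recip : X * pf * recip = recip - 1 := by
  linear_combination -one_sub_mul_recip

/-- The system for `j = 0`; it is the differential form of `pf = exp (X * pf)`. -/
theorem derivative_pf_eq : d⁄dX ℚ pf = d⁄dX ℚ (X * pf) * pf := by
  have h := isAreaSystem_areaSeries 0
  simp only [IsAreaSystem, Finset.Nat.antidiagonal_zero, Finset.sum_singleton,
    binomOp_zero] at h
  rw [Derivation.leibniz, derivative_X, smul_eq_mul, smul_eq_mul, mul_one]
  exact h

theorem derivative_X_mul_pf : d⁄dX ℚ (X * pf) = pf * recip := by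
  have h : d⁄dX ℚ (X * pf) = X * d⁄dX ℚ pf + pf := by
    rw [Derivation.leibniz, derivative_X, smul_eq_mul, smul_eq_mul, mul_one]
  linear_combination recip * h + recip * X * derivative_pf_eq -
    d⁄dX ℚ (X * pf) * one_sub_mul_recip

theorem derivative_pf : d⁄dX ℚ pf = pf ^ 2 * recip := by
  rw [derivative_pf_eq, derivative_X_mul_pf]
  ring

theorem derivative_recip : d⁄dX ℚ recip = pf * recip ^ 3 := by
  rw [recip, derivative_inv', map_sub, derivative_X_mul_pf, Derivation.map_one_eq_zero, ← recip]
  ring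

theorem constantCoeff_pf : constantCoeff pf = 1 := by
  rw [← coeff_zero_eq_constantCoeff_apply, pf, areaSeries, coeff_mk, areaMoment_zero]
  simp

theorem constantCoeff_recip : constantCoeff recip = 1 := by
  simp [recip]

/-! ### Polynomials in `recip` -/

/-- Evaluation of a list of integer coefficients. -/
def evalList {A : Type*} [CommRing A] (u : A) : List ℤ → A
  | [] => 0
  | a :: l => (a : A) + u * evalList u l

/-- Sum of coefficient lists. -/
def addList : List ℤ → List ℤ → List ℤ
  | [], m => m
  | l, [] => l
  | a :: l, b :: m => (a + b) :: addList l m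

/-- Scalar multiple of a coefficient list. -/
def smulList (c : ℤ) (l : List ℤ) : List ℤ := l.map (c * ·)

/-- Product of coefficient lists. -/
def mulList : List ℤ → List ℤ → List ℤ
  | [], _ => []
  | a :: l, m => addList (smulList a m) (0 :: mulList l m)

/-- Derivative of a coefficient list. -/
def derivList : List ℤ → List ℤ
  | [] => []
  | _ :: l => addList l (0 :: derivList l)

/-- Sum of a list of coefficient lists. -/
def sumList (L : List (List ℤ)) : List ℤ := L.foldr addList []

section evalList

variable {A : Type*} [CommRing A] (u : A)

theorem evalList_add (l m : List ℤ) :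
    evalList u (addList l m) = evalList u l + evalList u m := by
  induction l generalizing m with
  | nil => simp [addList, evalList]
  | cons a l ih =>
    cases m with
    | nil => simp [addList, evalList]
    | cons b m =>
      simp only [addList, evalList, ih]
      push_cast
      ring

theorem evalList_smul (c : ℤ) (l : List ℤ) :
    evalList u (smulList c l) = c * evalList u l := by
  induction l with
  | nil => simp [smulList, evalList]
  | cons a l ih =>
    simp only [smulList, List.map_cons, evalList] at ih ⊢
    rw [ih]
    push_cast
    ring

theorem evalList_mul (l m : List ℤ) :
    evalList u (mulList l m) = evalList u l * evalList u m := by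
  induction l with
  | nil => simp [mulList, evalList]
  | cons a l ih =>
    simp only [mulList, evalList_add, evalList_smul, evalList, ih]
    push_cast
    ring

theorem evalList_sum (L : List (List ℤ)) :
    evalList u (sumList L) = (L.map (evalList u)).sum := by
  induction L with
  | nil => rfl
  | cons l L ih =>
    rw [List.map_cons, List.sum_cons, ← ih, ← evalList_add]
    rfl

theorem evalList_eq_zero {l : List ℤ} (h : l.all (· == 0) = true) : evalList u l = 0 := by
  induction l with
  | nil => rfl
  | cons a l ih =>
    simp only [List.all_cons, Bool.and_eq_true, beq_iff_eq] at h
    rw [evalList, h.1, ih h.2]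
    simp

theorem evalList_derivation (D : Derivation ℚ ℚ⟦X⟧ ℚ⟦X⟧) (u : ℚ⟦X⟧) (l : List ℤ) :
    D (evalList u l) = evalList u (derivList l) * D u := by
  induction l with
  | nil => simp [evalList, derivList]
  | cons a l ih =>
    simp only [evalList, derivList, evalList_add, map_add, Derivation.leibniz, smul_eq_mul, ih,
      Derivation.map_intCast]
    push_cast
    ring

end evalList

/-- The coefficient list of `(pf * P(recip))' / pf ^ 2`. -/
def derivPf (l : List ℤ) : List ℤ := 0 :: addList l (0 :: 0 :: derivList l)

theorem derivative_pf_mul_evalList (l : List ℤ) :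
    d⁄dX ℚ (pf * evalList recip l) = pf ^ 2 * evalList recip (derivPf l) := by
  rw [Derivation.leibniz, evalList_derivation, derivative_pf, derivative_recip, derivPf]
  simp only [evalList, evalList_add, smul_eq_mul]
  push_cast
  ring

/-- The coefficient list of `X * (pf * P(recip))' / pf`. -/
def eulerPf (l : List ℤ) : List ℤ := mulList [-1, 1] (addList l (0 :: 0 :: derivList l))

/-- The relation `X * pf * recip = recip - 1` absorbs the factor `X`, so `X * d/dX` maps `pf *
ℚ[recip]` to itself. -/
theorem X_mul_derivative_pf_mul_evalList (l : List ℤ) :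
    X * d⁄dX ℚ (pf * evalList recip l) = pf * evalList recip (eulerPf l) := by
  rw [derivative_pf_mul_evalList, derivPf, eulerPf, evalList_mul]
  simp only [evalList, evalList_add]
  push_cast
  linear_combination pf * (evalList recip l + recip ^ 2 * evalList recip (derivList l)) *
    X_mul_pf_mul_recip

/-- The coefficient list of `(l + 1)! * binomOp l (pf * P(recip)) / pf`. -/
def binomPf : ℕ → List ℤ → List ℤ
  | 0, p => addList (eulerPf p) p
  | l + 1, p => addList (eulerPf (binomPf l p)) (smulList (-l) (binomPf l p))

theorem binomOp_pf_mul_evalList (l : ℕ) (p : List ℤ) :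
    ((l + 1).factorial : ℚ⟦X⟧) * binomOp l (pf * evalList recip p) =
      pf * evalList recip (binomPf l p) := by
  induction l with
  | zero =>
    rw [binomOp_zero, X_mul_derivative_pf_mul_evalList, binomPf, evalList_add]
    simp
    ring
  | succ l ih =>
    rw [binomPf, evalList_add, mul_add, ← X_mul_derivative_pf_mul_evalList, evalList_smul, ← ih,
      Nat.factorial_succ (l + 1), Derivation.leibniz, Derivation.map_natCast, smul_zero, add_zero,
      smul_eq_mul]
    have h := binomOp_succ l (pf * evalList recip p)
    push_cast
    linear_combination ((l + 1).factorial : ℚ⟦X⟧) * h - (l : ℚ⟦X⟧) * ih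

end ParkingArea

/-! ### Explicit solution of the differential system up to order six -/

namespace ParkingArea

open PowerSeries

/-- The coefficient lists of the polynomials `420 ^ j * R j`, where the exponential generating
function of the `j`-th binomial moments of the area is `pf * R j (recip)`. -/
def momentList : ℕ → List ℤ
  | 0 => [1]
  | 1 => [210, -420, 210]
  | 2 => [-14700, -7350, 0, 191100, -279300, 110250]
  | 3 => [3087000, 1543500, 0, -35500500, 129654000, -402853500, 666792000, -501637500,
      138915000]
  | 4 => [-821142000, -421375500, 0, 9318881250, -43434090000, 186442452000, -591611202000,
      1447100707500, -2416750560000, 2402434597500, -1260885150000, 268626881250]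
  | 5 => [245046060000, 129329865000, 0, -2814626272500, 14922851265000, -74796906397500,
      303875265960000, -1053845539425000, 3005394630210000, -6834384530190000, 11591450079300000,
      -13431842420062500, 9775579361625000, -3986167661437500, 692255119500000]
  | 6 => [-78323981400000, -42436834650000, 0, 917379842400000, -5291002005975000,
      29197924404862500, -136458663295500000, 568348997351625000, -2076123916403775000,
      6584843276062537500, -17710952178830400000, 39174708295551150000, -67997113125031125000,
      87254592493197937500, -77868311217700500000, 45070150189325625000, -15108256120348125000,
      2219868428695312500]
  | _ => []

/-- The coefficient list of `420 ^ j / pf ^ 2` times the right-hand side of the differential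
system, for the candidate solution given by `momentList`. -/
def systemList (j : ℕ) : List ℤ :=
  sumList ((List.Nat.antidiagonal j).map fun x =>
    sumList ((List.Nat.antidiagonal x.2).map fun y =>
      smulList (420 ^ x.1 / (x.1 + 1).factorial)
        (mulList (binomPf x.1 (momentList y.1)) (momentList y.2))))

/-- After division by `pf ^ 2` the system becomes seven identities between integer polynomials in
`recip`, small enough for kernel evaluation. -/
theorem derivPf_momentList : ∀ j ≤ 6,
    (addList (derivPf (momentList j)) (smulList (-1) (systemList j))).all (· == 0) = true := by
  decide +kernel

/-- The candidate solution of the differential system. -/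
noncomputable def momentSeries (j : ℕ) : ℚ⟦X⟧ :=
  C ((420 : ℚ) ^ j)⁻¹ * (pf * evalList recip (momentList j))

theorem binomOp_C_mul (l : ℕ) (c : ℚ) (F : ℚ⟦X⟧) : binomOp l (C c * F) = C c * binomOp l F := by
  ext k
  simp only [binomOp, coeff_mk, coeff_C_mul]
  ring

theorem binomOp_momentSeries {l : ℕ} (hl : l ≤ 6) (a : ℕ) :
    binomOp l (momentSeries a) = C ((420 : ℚ) ^ (l + a))⁻¹ *
      (pf * ((420 ^ l / (l + 1).factorial : ℤ) * evalList recip (binomPf l (momentList a)))) := by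
  have h := binomOp_pf_mul_evalList l (momentList a)
  have hd : ((420 ^ l / (l + 1).factorial : ℤ) : ℚ⟦X⟧) = C ((420 : ℚ) ^ l / (l + 1).factorial) := by
    -- This divisibility, with `420 = 2 ^ 2 * 3 * 5 * 7`, makes the integer division in `systemList`
    -- exact.
    have hdvd : ((l + 1).factorial : ℤ) ∣ 420 ^ l := by
      interval_cases l <;> decide
    rw [← map_intCast (C (R := ℚ)), Int.cast_div hdvd (by positivity)]
    push_cast
    rfl
  have hf : ((l + 1).factorial : ℚ⟦X⟧) = C ((l + 1).factorial : ℚ) :=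
    (map_natCast (C (R := ℚ)) _).symm
  have h0 : ((l + 1).factorial : ℚ) ≠ 0 := by positivity
  have h1 : C ((420 : ℚ) ^ (l + a))⁻¹ * C ((420 : ℚ) ^ l / (l + 1).factorial) *
      C ((l + 1).factorial : ℚ) = C ((420 : ℚ) ^ a)⁻¹ := by
    rw [← map_mul, ← map_mul]
    congr 1
    rw [pow_add]
    field_simp
  rw [momentSeries, binomOp_C_mul, hd, ← h1, ← hf]
  linear_combination C ((420 : ℚ) ^ (l + a))⁻¹ * C ((420 : ℚ) ^ l / (l + 1).factorial) * h

theorem sum_antidiagonal_eq_list_sum {M : Type*} [AddCommMonoid M] (j : ℕ) (f : ℕ × ℕ → M) :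
    ∑ x ∈ Finset.HasAntidiagonal.antidiagonal j, f x = ((List.Nat.antidiagonal j).map f).sum :=
  rfl

theorem evalList_systemList {A : Type*} [CommRing A] (u : A) (j : ℕ) :
    evalList u (systemList j) = ∑ x ∈ Finset.HasAntidiagonal.antidiagonal j,
      ∑ y ∈ Finset.HasAntidiagonal.antidiagonal x.2,
        (420 ^ x.1 / (x.1 + 1).factorial : ℤ) *
          (evalList u (binomPf x.1 (momentList y.1)) * evalList u (momentList y.2)) := by
  simp only [sum_antidiagonal_eq_list_sum, systemList, evalList_sum, List.map_map,
    Function.comp_def, evalList_smul, evalList_mul]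

theorem isAreaSystem_momentSeries {j : ℕ} (hj : j ≤ 6) : IsAreaSystem momentSeries j := by
  have h := evalList_eq_zero (recip) (derivPf_momentList j hj)
  rw [evalList_add, evalList_smul, evalList_systemList] at h
  have h1 : d⁄dX ℚ (momentSeries j) =
      C ((420 : ℚ) ^ j)⁻¹ * (pf ^ 2 * evalList recip (derivPf (momentList j))) := by
    rw [← derivative_pf_mul_evalList, momentSeries, ← smul_eq_C_mul, ← smul_eq_C_mul,
      Derivation.map_smul]
  have h2 : evalList recip (derivPf (momentList j)) =
      ∑ x ∈ Finset.HasAntidiagonal.antidiagonal j,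
      ∑ y ∈ Finset.HasAntidiagonal.antidiagonal x.2,
        (420 ^ x.1 / (x.1 + 1).factorial : ℤ) *
          (evalList recip (binomPf x.1 (momentList y.1)) * evalList recip (momentList y.2)) := by
    rw [← sub_eq_zero, ← h]
    push_cast
    ring
  rw [IsAreaSystem, h1, h2]
  simp only [Finset.mul_sum]
  refine Finset.sum_congr rfl fun x hx => Finset.sum_congr rfl fun y hy => ?_
  rw [Finset.HasAntidiagonal.mem_antidiagonal] at hx hy
  rw [binomOp_momentSeries (by omega), momentSeries]
  have h3 : C ((420 : ℚ) ^ (x.1 + y.1))⁻¹ * C ((420 : ℚ) ^ y.2)⁻¹ = C ((420 : ℚ) ^ j)⁻¹ := by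
    rw [← map_mul, ← mul_inv, ← pow_add]
    congr 3
    omega
  rw [← h3]
  ring

theorem constantCoeff_evalList (l : List ℤ) :
    constantCoeff (evalList recip l) = (l.sum : ℚ) := by
  induction l with
  | nil => simp [evalList]
  | cons a l ih => simp [evalList, ih, constantCoeff_recip]

theorem areaSeries_eq_momentSeries {j : ℕ} (hj : j ≤ 6) : areaSeries j = momentSeries j := by
  refine IsAreaSystem.eq (fun j _ => isAreaSystem_areaSeries j)
    (fun j hj => isAreaSystem_momentSeries hj) (fun j hj => ?_) hj
  have hsum : (momentList j).sum = if j = 0 then 1 else 0 := by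
    revert j
    decide
  rw [momentSeries, map_mul, map_mul, constantCoeff_evalList, constantCoeff_pf, constantCoeff_C,
    hsum, ← coeff_zero_eq_constantCoeff_apply, areaSeries, coeff_mk, areaMoment_zero]
  split_ifs with h
  · simp [h]
  · simp

end ParkingArea

namespace ParkingArea

open PowerSeries

/-! ### Coefficients of powers of the tree function -/

/-- The coefficient of `X ^ n / n!` in `pf * recip ^ k`. -/
noncomputable def treeCoeff (n k : ℕ) : ℚ := n.factorial * coeff n (pf * recip ^ k)

/-- Compare coefficients in `X * d/dX (pf * recip ^ k)`. For `k = 0` the left side vanishes, which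
leaves `treeCoeff n 2` as a second free parameter beside `treeCoeff n 0`. -/
theorem treeCoeff_rec (n k : ℕ) :
    k * treeCoeff n (k + 2) = (n + 1) * treeCoeff n k + (k - 1) * treeCoeff n (k + 1) := by
  have h : X * d⁄dX ℚ (pf * recip ^ k) = pf * recip ^ (k + 1) - pf * recip ^ k +
      C (k : ℚ) * (pf * recip ^ (k + 2)) - C (k : ℚ) * (pf * recip ^ (k + 1)) := by
    rw [Derivation.leibniz, Derivation.leibniz_pow, derivative_pf, derivative_recip, map_natCast]
    cases k with
    | zero =>
      simp
      linear_combination pf * X_mul_pf_mul_recip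
    | succ k =>
      simp only [nsmul_eq_mul, smul_eq_mul, Nat.add_sub_cancel]
      push_cast
      linear_combination (pf * recip ^ (k + 1) + (k + 1) * pf * recip ^ (k + 2)) *
        X_mul_pf_mul_recip
  have h1 := congrArg (coeff n) h
  rw [coeff_X_mul_derivative, map_sub, map_add, map_sub, coeff_C_mul, coeff_C_mul] at h1
  unfold treeCoeff
  linear_combination -(n.factorial : ℚ) * h1

/-- A case of Lagrange inversion. The exponent `m` must vary because `recip = 1 + X * pf * recip`
trades `(n + 1, m)` for `(n, m + 1)`; the sum `m + 1 + n` is preserved. -/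
theorem coeff_pf_pow_mul_recip (n m : ℕ) :
    coeff n (pf ^ (m + 1) * recip) = (m + 1 + n : ℚ) ^ n / n.factorial := by
  induction n generalizing m with
  | zero =>
    simp [coeff_zero_eq_constantCoeff_apply, constantCoeff_pf, constantCoeff_recip]
  | succ n ih =>
    have h : X * d⁄dX ℚ (pf ^ (m + 1)) =
        C ((m : ℚ) + 1) * (pf ^ (m + 1) * recip - pf ^ (m + 1)) := by
      rw [Derivation.leibniz_pow, derivative_pf, map_add, map_natCast, map_one]
      simp only [nsmul_eq_mul, smul_eq_mul, Nat.add_sub_cancel]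
      push_cast
      linear_combination (m + 1) * pf ^ (m + 1) * X_mul_pf_mul_recip
    have h1 := congrArg (coeff (n + 1)) h
    have h2 : pf ^ (m + 1) * recip = pf ^ (m + 1) + X * (pf ^ (m + 1 + 1) * recip) := by
      linear_combination -pf ^ (m + 1) * X_mul_pf_mul_recip
    have h3 := congrArg (coeff (n + 1)) h2
    rw [map_add, coeff_succ_X_mul, ih] at h3
    rw [coeff_X_mul_derivative, coeff_C_mul, map_sub] at h1
    have h4 : ((n : ℚ) + 1) * coeff (n + 1) (pf ^ (m + 1) * recip) =
        (m + n + 2) * ((m + 1 + 1 + n : ℚ) ^ n / n.factorial) := by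
      push_cast at h1 h3
      linear_combination h1 + (m + n + 2) * h3
    have h5 : ((n : ℚ) + 1) ≠ 0 := by positivity
    apply mul_left_cancel₀ h5
    rw [h4, Nat.factorial_succ]
    push_cast
    have h6 : (n.factorial : ℚ) ≠ 0 := by positivity
    field_simp
    ring

/-- The same trade, each step splitting off the top term of the sum. -/
theorem coeff_pf_pow_mul_recip_sq (n m : ℕ) : coeff n (pf ^ (m + 1) * recip ^ 2) =
    ∑ k ∈ Finset.range (n + 1), (m + 1 + n : ℚ) ^ k / k.factorial := by
  induction n generalizing m with
  | zero =>
    simp [coeff_zero_eq_constantCoeff_apply, constantCoeff_pf, constantCoeff_recip]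
  | succ n ih =>
    have h : pf ^ (m + 1) * recip ^ 2 =
        pf ^ (m + 1) * recip + X * (pf ^ (m + 1 + 1) * recip ^ 2) := by
      linear_combination -pf ^ (m + 1) * recip * X_mul_pf_mul_recip
    rw [h, map_add, coeff_succ_X_mul, ih, coeff_pf_pow_mul_recip,
      Finset.sum_range_succ _ (n + 1), add_comm]
    push_cast
    congr 1
    refine Finset.sum_congr rfl fun k _ => ?_
    ring

theorem treeCoeff_one (n : ℕ) : treeCoeff n 1 = (n + 1 : ℚ) ^ n := by
  have h := coeff_pf_pow_mul_recip n 0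
  have h0 : (n.factorial : ℚ) ≠ 0 := by positivity
  rw [zero_add, pow_one] at h
  rw [treeCoeff, pow_one, h, mul_div_cancel₀ _ h0]
  simp [add_comm]

theorem treeCoeff_two (n : ℕ) : treeCoeff n 2 =
    n.factorial * ∑ k ∈ Finset.range (n + 1), (n + 1 : ℚ) ^ k / k.factorial := by
  have h := coeff_pf_pow_mul_recip_sq n 0
  rw [zero_add, pow_one] at h
  rw [treeCoeff, h]
  simp [add_comm]

theorem treeCoeff_zero (n : ℕ) : (n + 1) * treeCoeff n 0 = (n + 1 : ℚ) ^ n := by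
  have h := treeCoeff_rec n 0
  rw [← treeCoeff_one]
  push_cast at h
  linear_combination -h

theorem treeCoeff_zero_pos (n : ℕ) : 0 < treeCoeff n 0 := by
  have h := treeCoeff_zero n
  have h1 : (0 : ℚ) < (n + 1 : ℚ) ^ n := by positivity
  rw [← h] at h1
  exact pos_of_mul_pos_right h1 (by positivity)

/-! ### Moments in terms of tree coefficients -/

/-- The combination of the values of `a` from `s` on with a list of coefficients. -/
def dotList (a : ℕ → ℚ) : List ℤ → ℕ → ℚ
  | [], _ => 0
  | c :: l, s => c * a s + dotList a l (s + 1)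

theorem coeff_pf_mul_evalList (n : ℕ) (l : List ℤ) (s : ℕ) :
    n.factorial * coeff n (pf * recip ^ s * evalList recip l) = dotList (treeCoeff n) l s := by
  induction l generalizing s with
  | nil => simp [evalList, dotList]
  | cons c l ih =>
    have h : pf * recip ^ s * evalList recip (c :: l) =
        C (c : ℚ) * (pf * recip ^ s) + pf * recip ^ (s + 1) * evalList recip l := by
      rw [evalList, map_intCast]
      ring
    rw [h, map_add, coeff_C_mul, dotList, ← ih, treeCoeff]
    ring

theorem areaMoment_eq_dotList {j : ℕ} (hj : j ≤ 6) (n : ℕ) :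
    areaMoment j n = ((420 : ℚ) ^ j)⁻¹ * dotList (treeCoeff n) (momentList j) 0 := by
  have h := congrArg (coeff n) (areaSeries_eq_momentSeries hj)
  rw [areaSeries, coeff_mk, momentSeries, coeff_C_mul,
    div_eq_iff (by positivity : (n.factorial : ℚ) ≠ 0)] at h
  rw [h, ← coeff_pf_mul_evalList, pow_zero, mul_one]
  ring

theorem areaMoment_zero_left (n : ℕ) : areaMoment 0 n = treeCoeff n 0 := by
  rw [areaMoment_eq_dotList (by norm_num)]
  simp [momentList, dotList]

theorem areaMoment_one (n : ℕ) :
    areaMoment 1 n = treeCoeff n 2 / 2 - treeCoeff n 1 + treeCoeff n 0 / 2 := by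
  rw [areaMoment_eq_dotList (by norm_num)]
  simp only [momentList, dotList]
  push_cast
  ring

/-- The expected area as a rational number. -/
noncomputable def meanArea (n : ℕ) : ℚ := areaMoment 1 n / areaMoment 0 n

theorem meanArea_eq (n : ℕ) : meanArea n =
    -(n : ℚ) / 2 + 1 / 2 * (((n + 1).factorial : ℚ) / ((n : ℚ) + 1) ^ n) *
      ∑ k ∈ Finset.range n, ((n : ℚ) + 1) ^ k / (k.factorial : ℚ) := by
  have h0 := treeCoeff_zero n
  have hN : ((n : ℚ) + 1) ≠ 0 := by positivity
  have hp : ((n : ℚ) + 1) ^ n ≠ 0 := by positivity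
  have h00 : treeCoeff n 0 = (n + 1 : ℚ) ^ n / (n + 1) := by
    rw [← h0]
    field_simp
  have hf : (n.factorial : ℚ) ≠ 0 := by positivity
  rw [meanArea, areaMoment_zero_left, areaMoment_one, treeCoeff_one, treeCoeff_two, h00,
    Finset.sum_range_succ, Nat.factorial_succ]
  push_cast
  field_simp
  ring

/-! ### Reduction of the moments to the mean -/

section relations

variable (n : ℕ)

theorem treeCoeff_two_eq : treeCoeff n 2 = (2 * meanArea n + 2 * n + 1) * treeCoeff n 0 := by
  have h1 := areaMoment_one n
  have h2 : areaMoment 1 n = meanArea n * treeCoeff n 0 := by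
    rw [meanArea, areaMoment_zero_left, div_mul_cancel₀ _ (treeCoeff_zero_pos n).ne']
  have h3 := treeCoeff_rec n 0
  push_cast at h3
  linear_combination -2 * h1 + 2 * h2 + 2 * h3

theorem treeCoeff_succ_eq (k : ℕ) : treeCoeff n (k + 3) =
    ((n + 1) * treeCoeff n (k + 1) + k * treeCoeff n (k + 2)) / (k + 1) := by
  have h := treeCoeff_rec n (k + 1)
  have hk : (k : ℚ) + 1 ≠ 0 := by positivity
  rw [eq_div_iff hk]
  push_cast at h
  linear_combination h

theorem areaMoment_two : 2 * areaMoment 2 n = (5 / 12 * (n + 1 : ℚ) ^ 3 - 4 / 3 * (n + 1) ^ 2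
    + 13 / 12 * (n + 1) - 1 / 6 - 7 / 3 * (n + 1) * meanArea n) * areaMoment 0 n := by
  have h1 : treeCoeff n 1 = (n + 1) * treeCoeff n 0 := by
    rw [treeCoeff_one, treeCoeff_zero]
  have h2 := treeCoeff_two_eq n
  have h := treeCoeff_succ_eq n
  have h3 := h 0
  have h4 := h 1
  have h5 := h 2
  simp only [Nat.reduceAdd, h1, h2] at h3
  simp only [Nat.reduceAdd, h2, h3] at h4
  simp only [Nat.reduceAdd, h3, h4] at h5
  rw [areaMoment_zero_left, areaMoment_eq_dotList (by norm_num)]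
  simp only [momentList, dotList, Nat.reduceAdd, h1, h2, h3, h4, h5]
  push_cast
  ring

theorem areaMoment_six : 720 * areaMoment 6 n = (82825 / 576576 * (n : ℚ) ^ 9
          + 373340075 / 110702592 * (n : ℚ) ^ 8
          + 9401544029 / 332107776 * (n : ℚ) ^ 7
          + 14473244813 / 127733760 * (n : ℚ) ^ 6
          + 414139396709 / 1660538880 * (n : ℚ) ^ 5
          + 88215445651 / 332107776 * (n : ℚ) ^ 4
          - 18783816473 / 332107776 * (n : ℚ) ^ 3
          - 643359542029 / 1660538880 * (n : ℚ) ^ 2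
          - 358936540409 / 1660538880 * (n : ℚ)
          + (-(3955 / 2048) * (n : ℚ) ^ 7
              - 186349 / 6144 * (n : ℚ) ^ 6
              - 259283273 / 1161216 * (n : ℚ) ^ 5
              - 119912501 / 129024 * (n : ℚ) ^ 4
              - 149860633081 / 63866880 * (n : ℚ) ^ 3
              - 601794266581 / 166053888 * (n : ℚ) ^ 2
              - 864000570107 / 276756480 * (n : ℚ)
              - 921390308389 / 830269440) * meanArea n) * areaMoment 0 n := by
  have h1 : treeCoeff n 1 = (n + 1) * treeCoeff n 0 := by
    rw [treeCoeff_one, treeCoeff_zero]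
  have h2 := treeCoeff_two_eq n
  have h := treeCoeff_succ_eq n
  rw [areaMoment_zero_left, areaMoment_eq_dotList (by norm_num)]
  -- `momentList 6` has degree 17, and `h k` eliminates `treeCoeff n (k + 3)`, so `h 14` down to `h
  -- 0` leave only indices 0, 1 and 2.
  simp only [momentList, dotList, Nat.reduceAdd, h 14, h 13, h 12, h 11, h 10, h 9, h 8, h 7, h 6,
    h 5, h 4, h 3, h 2, h 1, h 0, h1, h2]
  push_cast
  ring

end relations

end ParkingArea

/-! ### Growth of the mean and asymptotics -/

namespace ParkingArea

theorem areaMoment_zero_left_pos (n : ℕ) : 0 < areaMoment 0 n := by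
  rw [areaMoment_zero_left]
  exact treeCoeff_zero_pos n

theorem E₁_eq_meanArea (n : ℕ) : E₁ n = (meanArea n : ℚ) := by
  rw [E₁_eq, meanArea, Rat.cast_div]

theorem meanArea_nonneg (n : ℕ) : 0 ≤ meanArea n :=
  div_nonneg (Finset.sum_nonneg fun _ _ => Nat.cast_nonneg _) (areaMoment_zero_left_pos n).le

/-- Cauchy–Schwarz, with the second moment written through binomial moments. -/
theorem areaMoment_one_sq_le (n : ℕ) :
    areaMoment 1 n ^ 2 ≤ areaMoment 0 n * (2 * areaMoment 2 n + areaMoment 1 n) := by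
  have h := sq_sum_le_card_mul_sum_sq (s := parkingFunctions n)
    (f := fun p => (natArea p : ℚ))
  have h0 : areaMoment 0 n = (parkingFunctions n).card := by simp [areaMoment]
  have h1 : areaMoment 1 n = ∑ p ∈ parkingFunctions n, (natArea p : ℚ) := by simp [areaMoment]
  have h2 : 2 * areaMoment 2 n + areaMoment 1 n =
      ∑ p ∈ parkingFunctions n, (natArea p : ℚ) ^ 2 := by
    rw [h1, areaMoment, Finset.mul_sum, ← Finset.sum_add_distrib]
    refine Finset.sum_congr rfl fun p _ => ?_
    rw [Nat.cast_choose_two]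
    ring
  rwa [h2, h0, h1]

/-- In the second moment the mean occurs with the nonpositive factor `1 - 7 / 3 * (n + 1)` and can
be dropped, so no asymptotics of the explicit sum are needed. -/
theorem meanArea_sq_le (n : ℕ) : meanArea n ^ 2 ≤ (n + 1 : ℚ) ^ 3 := by
  have h0 := areaMoment_zero_left_pos n
  have h1 := areaMoment_one_sq_le n
  have h2 : areaMoment 1 n = meanArea n * areaMoment 0 n := (div_mul_cancel₀ _ h0.ne').symm
  have he := meanArea_nonneg n
  rw [areaMoment_two, h2] at h1
  set N : ℚ := (n : ℚ) + 1 with hN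
  have hN1 : 1 ≤ N := by
    rw [hN]
    linarith [(Nat.cast_nonneg n : (0 : ℚ) ≤ n)]
  have h3 : meanArea n ^ 2 ≤ 5 / 12 * N ^ 3 - 4 / 3 * N ^ 2
    + 13 / 12 * N - 1 / 6 - 7 / 3 * N * meanArea n + meanArea n := by
    have h4 : 0 < areaMoment 0 n ^ 2 := by positivity
    refine le_of_mul_le_mul_right ?_ h4
    linarith
  nlinarith [mul_nonneg (sub_nonneg.2 hN1) he, mul_nonneg (sub_nonneg.2 hN1) (sub_nonneg.2 hN1),
    mul_nonneg (mul_nonneg (sub_nonneg.2 hN1) (sub_nonneg.2 hN1)) (sub_nonneg.2 hN1)]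

theorem isBigO_E₁ : E₁ =O[atTop] fun n : ℕ => (n : ℝ) ^ (3 / 2 : ℝ) := by
  -- The constant 3 suffices because `(n + 1) ^ 3 ≤ 8 * n ^ 3 ≤ 9 * n ^ 3`.
  refine IsBigO.of_bound 3 ?_
  filter_upwards [eventually_ge_atTop 1] with n hn
  have hn1 : (1 : ℝ) ≤ n := by exact_mod_cast hn
  have h1 : E₁ n ^ 2 ≤ (n + 1 : ℝ) ^ 3 := by
    rw [E₁_eq_meanArea]
    exact_mod_cast meanArea_sq_le n
  have h2 : ((n : ℝ) ^ (3 / 2 : ℝ)) ^ 2 = (n : ℝ) ^ 3 := by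
    rw [← Real.rpow_natCast, ← Real.rpow_mul (by positivity), ← Real.rpow_natCast]
    norm_num
  have h3 : (0 : ℝ) ≤ (n : ℝ) ^ (3 / 2 : ℝ) := by positivity
  rw [Real.norm_eq_abs, Real.norm_of_nonneg h3]
  apply abs_le_of_sq_le_sq _ (by positivity)
  rw [mul_pow, h2]
  have h4 : (n + 1 : ℝ) ^ 3 ≤ (2 * n) ^ 3 := by
    gcongr
    linarith
  have h5 : (0 : ℝ) ≤ (n : ℝ) ^ 3 := by positivity
  nlinarith

theorem isBigO_const_mul_pow (c : ℝ) {i k : ℕ} (h : i ≤ k) :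
    (fun n : ℕ => c * (n : ℝ) ^ i) =O[atTop] fun n : ℕ => (n : ℝ) ^ k := by
  refine IsBigO.const_mul_left (IsBigO.of_bound 1 ?_) c
  filter_upwards [eventually_ge_atTop 1] with n hn
  rw [one_mul, Real.norm_of_nonneg (by positivity), Real.norm_of_nonneg (by positivity)]
  exact pow_le_pow_right₀ (by exact_mod_cast hn) h

theorem isBigO_pow_mul_E₁ :
    (fun n : ℕ => (n : ℝ) ^ 7 * E₁ n) =O[atTop] fun n : ℕ => (n : ℝ) ^ (17 / 2 : ℝ) := by
  refine ((isBigO_refl _ _).mul isBigO_E₁).trans_eventuallyEq ?_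
  filter_upwards [eventually_ge_atTop 1] with n hn
  have hn0 : (0 : ℝ) < n := by exact_mod_cast hn
  rw [← Real.rpow_natCast, ← Real.rpow_add hn0]
  norm_num

theorem isBigO_pow_eight :
    (fun n : ℕ => (n : ℝ) ^ 8) =O[atTop] fun n : ℕ => (n : ℝ) ^ (17 / 2 : ℝ) := by
  refine IsBigO.of_bound 1 ?_
  filter_upwards [eventually_ge_atTop 1] with n hn
  rw [one_mul, Real.norm_of_nonneg (by positivity), Real.norm_of_nonneg (by positivity),
    ← Real.rpow_natCast]
  exact Real.rpow_le_rpow_of_exponent_le (by exact_mod_cast hn) (by norm_num)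

theorem factorialMoment_six (n : ℕ) : factorialMoment 6 n =
        82825 / 576576 * (n : ℝ) ^ 9
          + 373340075 / 110702592 * (n : ℝ) ^ 8
          + 9401544029 / 332107776 * (n : ℝ) ^ 7
          + 14473244813 / 127733760 * (n : ℝ) ^ 6
          + 414139396709 / 1660538880 * (n : ℝ) ^ 5
          + 88215445651 / 332107776 * (n : ℝ) ^ 4
          - 18783816473 / 332107776 * (n : ℝ) ^ 3
          - 643359542029 / 1660538880 * (n : ℝ) ^ 2
          - 358936540409 / 1660538880 * (n : ℝ)
          + (-(3955 / 2048) * (n : ℝ) ^ 7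
              - 186349 / 6144 * (n : ℝ) ^ 6
              - 259283273 / 1161216 * (n : ℝ) ^ 5
              - 119912501 / 129024 * (n : ℝ) ^ 4
              - 149860633081 / 63866880 * (n : ℝ) ^ 3
              - 601794266581 / 166053888 * (n : ℝ) ^ 2
              - 864000570107 / 276756480 * (n : ℝ)
              - 921390308389 / 830269440) * E₁ n := by
  have h := areaMoment_six n
  have h0 : (areaMoment 0 n : ℝ) ≠ 0 := by exact_mod_cast (areaMoment_zero_left_pos n).ne'
  rw [factorialMoment_eq, div_eq_iff h0, E₁_eq_meanArea]
  have hf : ((Nat.factorial 6 : ℕ) : ℝ) = 720 := by norm_num [Nat.factorial]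
  rw [hf]
  have h1 := congrArg (Rat.cast : ℚ → ℝ) h
  push_cast at h1
  exact h1

end ParkingArea

theorem theorem6 :
    (∀ n : ℕ,
      ParkingArea.E₁ n =
        -(n : ℝ) / 2 + 1 / 2 * (((n + 1).factorial : ℝ) / ((n : ℝ) + 1) ^ n) *
          ∑ k ∈ Finset.range n, ((n : ℝ) + 1) ^ k / (k.factorial : ℝ)) ∧
    (∀ n : ℕ,
      ParkingArea.factorialMoment 6 n =
        82825 / 576576 * (n : ℝ) ^ 9
          + 373340075 / 110702592 * (n : ℝ) ^ 8
          + 9401544029 / 332107776 * (n : ℝ) ^ 7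
          + 14473244813 / 127733760 * (n : ℝ) ^ 6
          + 414139396709 / 1660538880 * (n : ℝ) ^ 5
          + 88215445651 / 332107776 * (n : ℝ) ^ 4
          - 18783816473 / 332107776 * (n : ℝ) ^ 3
          - 643359542029 / 1660538880 * (n : ℝ) ^ 2
          - 358936540409 / 1660538880 * (n : ℝ)
          + (-(3955 / 2048) * (n : ℝ) ^ 7
              - 186349 / 6144 * (n : ℝ) ^ 6
              - 259283273 / 1161216 * (n : ℝ) ^ 5
              - 119912501 / 129024 * (n : ℝ) ^ 4
              - 149860633081 / 63866880 * (n : ℝ) ^ 3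
              - 601794266581 / 166053888 * (n : ℝ) ^ 2
              - 864000570107 / 276756480 * (n : ℝ)
              - 921390308389 / 830269440) * ParkingArea.E₁ n) ∧
    (fun n : ℕ => ParkingArea.factorialMoment 6 n - 82825 / 576576 * (n : ℝ) ^ 9)
      =O[atTop] fun n : ℕ => (n : ℝ) ^ (17 / 2 : ℝ) := by
  refine ⟨fun n => ?_, ParkingArea.factorialMoment_six, ?_⟩
  · rw [ParkingArea.E₁_eq_meanArea, ParkingArea.meanArea_eq]
    push_cast
    rfl
  · have hc := @ParkingArea.isBigO_const_mul_pow
    have hP := ((((((((hc (373340075 / 110702592) (le_refl 8)).add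
      (hc (9401544029 / 332107776) (show 7 ≤ 8 by norm_num))).add
      (hc (14473244813 / 127733760) (show 6 ≤ 8 by norm_num))).add
      (hc (414139396709 / 1660538880) (show 5 ≤ 8 by norm_num))).add
      (hc (88215445651 / 332107776) (show 4 ≤ 8 by norm_num))).sub
      (hc (18783816473 / 332107776) (show 3 ≤ 8 by norm_num))).sub
      (hc (643359542029 / 1660538880) (show 2 ≤ 8 by norm_num))).sub
      (hc (358936540409 / 1660538880) (show 1 ≤ 8 by norm_num))).trans
      ParkingArea.isBigO_pow_eight
    -- The factor of `E₁` is `O(n ^ 7)`; with `E₁ = O(n ^ (3/2))` this term produces the exponent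
    -- `17 / 2`.
    have hQ := ((((((((hc (-(3955 / 2048)) (le_refl 7)).sub
      (hc (186349 / 6144) (show 6 ≤ 7 by norm_num))).sub
      (hc (259283273 / 1161216) (show 5 ≤ 7 by norm_num))).sub
      (hc (119912501 / 129024) (show 4 ≤ 7 by norm_num))).sub
      (hc (149860633081 / 63866880) (show 3 ≤ 7 by norm_num))).sub
      (hc (601794266581 / 166053888) (show 2 ≤ 7 by norm_num))).sub
      (hc (864000570107 / 276756480) (show 1 ≤ 7 by norm_num))).sub
      (hc (921390308389 / 830269440) (show 0 ≤ 7 by norm_num))).mul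
      (isBigO_refl ParkingArea.E₁ atTop)
    refine (hP.add (hQ.trans ParkingArea.isBigO_pow_mul_E₁)).congr_left fun n => ?_
    rw [ParkingArea.factorialMoment_six]
    ring
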